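/- Let $\mathbb H=\{\lambda\in\mathbb C:\operatorname{Im}\lambda>0\}$, let $f:\mathbb H^n\to\mathbb H$ be holomorphic with $f(\lambda,\dots,\lambda)=\lambda$ for all $\lambda\in\mathbb H$, and set $\alpha_j=\frac{\partial f}{\partial z_j}(i,\dots,i)$ and $\mathbf g(z)=\sum_{j=1}^n\alpha_j z_j$. For $t\in\mathbb R$ let $f_t(z_1,\dots,z_n)=f(z_1-t,\dots,z_n-t)+t$. Let $\mathcal D$ be the space of all holomorphic maps $h:\mathbb H^n\to\mathbb H$ with $h(\lambda,\dots,\lambda)=\lambda$ for all $\lambda\in\mathbb H$, equipped with the compact-open topology. Then $\mathbf g\in\mathcal D$, and the following two (equivalent) statements hold. (a) For every open neighbourhood $U$ of $\mathbf g$ in $\mathcal D$ and every $\varepsilon>0$ there is an $R$ such that for all $r\ge R$ the set $\{t\in[-\frac r2,\frac r2] : f_t\in U\}$ has Lebesgue measure at least $(1-\varepsilon)r$. (b) For $r>0$ let $\mu_r$ be the Borel probability measure on $\mathcal D$ obtained by pushing forward the uniform probability measure on $[-r,r]$ under the map $t\mapsto f_t$. Then $\mu_r\to\delta_{\mathbf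 g}$ weakly as $r\to\infty$. -/

import Mathlib

open MeasureTheory ProbabilityTheory Filter Topology
open scoped UpperHalfPlane

/-- Holomorphy of a map `f : ℍⁿ → ℍ`: read in the standard coordinates, `f` is complex
differentiable on the open subset `{w | ∀ j, 0 < Im w_j}` of `ℂⁿ`. (`UpperHalfPlane.ofComplex` is
the inverse of the inclusion `ℍ → ℂ`, with a junk value outside the upper half-plane.) -/
def IsHolomorphic {n : ℕ} (f : (Fin n → ℍ) → ℍ) : Prop :=
  DifferentiableOn ℂ
    (fun w : Fin n → ℂ => (f (fun j => UpperHalfPlane.ofComplex (w j)) : ℂ))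
    {w | ∀ j, 0 < (w j).im}

/-- The complex partial derivative `∂f/∂z_j` at the point `z` of `ℍⁿ`. -/
noncomputable def partialDeriv {n : ℕ} (f : (Fin n → ℍ) → ℍ) (j : Fin n) (z : Fin n → ℍ) : ℂ :=
  deriv (fun w : ℂ => (f (Function.update z j (UpperHalfPlane.ofComplex w)) : ℂ)) (z j : ℂ)

/-- The family of holomorphic maps `f : ℍⁿ → ℍ` that restrict to the identity on the diagonal. -/
structure DiagFamily (n : ℕ) where
  toFun : (Fin n → ℍ) → ℍ
  holomorphic : IsHolomorphic toFun
  diag : ∀ c : ℍ, toFun (fun _ => c) = c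

theorem IsHolomorphic.continuous {n : ℕ} {f : (Fin n → ℍ) → ℍ} (hf : IsHolomorphic f) :
    Continuous f := by
  rw [UpperHalfPlane.isEmbedding_coe.continuous_iff]
  have h := hf.continuousOn.comp_continuous
    (f := fun (z : Fin n → ℍ) (j : Fin n) => ((z j : ℍ) : ℂ))
    (continuous_pi fun j => UpperHalfPlane.continuous_coe.comp (continuous_apply j))
    (fun z j => (z j).im_pos)
  simpa [UpperHalfPlane.ofComplex_apply, Function.comp_def] using h

theorem IsHolomorphic.translate {n : ℕ} {f : (Fin n → ℍ) → ℍ} (hf : IsHolomorphic f) (t : ℝ) :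
    IsHolomorphic (fun z : Fin n → ℍ => t +ᵥ f (fun j => (-t) +ᵥ z j)) := by
  have hd : DifferentiableOn ℂ (fun w : Fin n → ℂ => fun j => w j - (t : ℂ))
      {w : Fin n → ℂ | ∀ j, 0 < (w j).im} := by fun_prop
  have h := DifferentiableOn.comp hf hd (fun w hw j => by simpa using hw j)
  refine ((differentiableOn_const (t : ℂ)).add h).congr fun w hw => ?_
  simp only [UpperHalfPlane.coe_vadd, Pi.add_apply, Function.comp_apply]
  congr 3
  funext j
  have hw' : 0 < (w j - (t : ℂ)).im := by simpa using hw j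
  apply UpperHalfPlane.ext
  rw [UpperHalfPlane.coe_vadd, UpperHalfPlane.ofComplex_apply_of_im_pos (hw j),
    UpperHalfPlane.ofComplex_apply_of_im_pos hw']
  push_cast
  ring

namespace DiagFamily

def toContinuousMap {n : ℕ} (f : DiagFamily n) : C(Fin n → ℍ, ℍ) :=
  ⟨f.toFun, f.holomorphic.continuous⟩

/-- The compact-open topology (Mathlib's topology on `C(ℍⁿ, ℍ)` is the compact-open one). -/
noncomputable instance (n : ℕ) : TopologicalSpace (DiagFamily n) :=
  TopologicalSpace.induced toContinuousMap inferInstance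

noncomputable instance (n : ℕ) : MeasurableSpace (DiagFamily n) := borel _

instance (n : ℕ) : BorelSpace (DiagFamily n) := ⟨rfl⟩

/-- The translation flow `f_t(z_1, …, z_n) = f(z_1 - t, …, z_n - t) + t`. -/
noncomputable def translate {n : ℕ} (f : DiagFamily n) (t : ℝ) : DiagFamily n where
  toFun z := t +ᵥ f.toFun (fun j => (-t) +ᵥ z j)
  holomorphic := f.holomorphic.translate t
  diag c := by rw [f.diag, vadd_vadd]; simp

theorem continuous_translate {n : ℕ} (f : DiagFamily n) : Continuous f.translate := by
  rw [continuous_induced_rng]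
  refine ContinuousMap.continuous_of_continuous_uncurry _ ?_
  change Continuous fun p : ℝ × (Fin n → ℍ) => p.1 +ᵥ f.toFun (fun j => (-p.1) +ᵥ p.2 j)
  have hv : Continuous fun q : ℝ × ℍ => q.1 +ᵥ q.2 := by
    rw [UpperHalfPlane.isEmbedding_coe.continuous_iff]
    change Continuous fun q : ℝ × ℍ => ((q.1 +ᵥ q.2 : ℍ) : ℂ)
    simp only [UpperHalfPlane.coe_vadd]
    exact (Complex.continuous_ofReal.comp continuous_fst).add
      (UpperHalfPlane.continuous_coe.comp continuous_snd)
  refine hv.comp (continuous_fst.prodMk (f.holomorphic.continuous.comp (continuous_pi fun j => ?_)))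
  exact hv.comp (continuous_fst.neg.prodMk ((continuous_apply j).comp continuous_snd))

/-- The pushforward to `DiagFamily n` of the uniform probability measure on `[-r, r]`
under `t ↦ f_t`. -/
noncomputable def orbitMeasure {n : ℕ} (f : DiagFamily n) (r : Set.Ioi (0 : ℝ)) :
    ProbabilityMeasure (DiagFamily n) :=
  ⟨(ProbabilityTheory.cond (volume : Measure ℝ) (Set.Icc (-(r : ℝ)) r)).map f.translate, by
    have hr : (0 : ℝ) < r := r.2
    have : IsProbabilityMeasure
        (ProbabilityTheory.cond (volume : Measure ℝ) (Set.Icc (-(r : ℝ)) r)) :=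
      cond_isProbabilityMeasure_of_finite
        (by rw [Real.volume_Icc]; simp; linarith) (by simp [Real.volume_Icc])
    exact Measure.isProbabilityMeasure_map f.continuous_translate.measurable.aemeasurable⟩

end DiagFamily

/-! Everything rests on Schwarz–Pick: `f` does not increase the supremum of the hyperbolic
distances. At a diagonal point this makes the differential a contraction for the sup norm, while the
diagonal condition makes the partial derivatives sum to 1. Hence they are real and nonnegative;
being holomorphic along the diagonal as well, they are constant there. So one linear map `g` is the
first-order part of `f` at every diagonal point `c`, with an error of order `‖v‖ ^ 2 / c.im`.

Fix `z` and let `u(l) = f(z + l) - l - g(z)`. It is holomorphic for `0 ≤ Im l`, bounded on strips,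
and small high up, so shifting the contour shows that `u` and `u ^ 2` have mean zero on the real
line. As `|u|² = Re(u²) + 2 (Im u)²`, it remains to see that `|Im u|` has mean zero. For this,
compare `f` at `x + iy` and at `x + isy`: Schwarz–Pick bounds the second height, divided by `s`, by
the first. For large `s` the second height varies so slowly that its mean value bounds it pointwise
from above. Both rescaled heights have the same mean, which forces both to be close to it in `L¹`
(`uniformMeanZero_abs_height`).

Chebyshev's inequality gives closeness to `g` at one point `z` for most `t`. Equicontinuity reduces
a compact-open neighbourhood to finitely many points, and the portmanteau theorem gives weak
convergence. -/

/-! ### The Cayley transform and the Schwarz–Pick lemma on the polydisc. -/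

theorem Real.tanh_le_tanh_iff {x y : ℝ} : Real.tanh x ≤ Real.tanh y ↔ x ≤ y := by
  rw [← Real.artanh_le_artanh_iff (Real.tanh_bijOn.mapsTo (Set.mem_univ x))
    (Real.tanh_bijOn.mapsTo (Set.mem_univ y)), Real.artanh_tanh, Real.artanh_tanh]

theorem UpperHalfPlane.dist_coe_conj_pos (z w : ℍ) : 0 < ‖(w : ℂ) - (starRingEnd ℂ) (z : ℂ)‖ := by
  rw [norm_pos_iff]
  intro h
  have := congrArg Complex.im h
  simp at this
  have h1 := z.im_pos
  have h2 := w.im_pos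
  linarith

theorem UpperHalfPlane.norm_sub_lt_norm_sub_conj (z w : ℍ) :
    ‖(w : ℂ) - z‖ < ‖(w : ℂ) - (starRingEnd ℂ) (z : ℂ)‖ := by
  have h1 := z.im_pos
  have h2 := w.im_pos
  rw [← sq_lt_sq₀ (norm_nonneg _) (norm_nonneg _), Complex.sq_norm, Complex.sq_norm,
    Complex.normSq_apply, Complex.normSq_apply]
  simp
  nlinarith [mul_pos h1 h2]

theorem UpperHalfPlane.norm_cayley (z w : ℍ) :
    ‖((w : ℂ) - z) / (w - (starRingEnd ℂ) (z : ℂ))‖ = Real.tanh (dist z w / 2) := by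
  rw [dist_comm, UpperHalfPlane.tanh_half_dist, norm_div, dist_eq_norm, dist_eq_norm]

/-- The imaginary part equals `z.im * (1 - ‖c‖ ^ 2) / ‖1 - c‖ ^ 2`. -/
theorem UpperHalfPlane.im_cayley_inv_pos (z : ℍ) {c : ℂ} (hc : ‖c‖ < 1) :
    0 < (((z : ℂ) - (starRingEnd ℂ) (z : ℂ) * c) / (1 - c)).im := by
  have hne : 1 - c ≠ 0 := by
    intro h
    have : c = 1 := by linear_combination -h
    simp [this] at hc
  have hn : 0 < Complex.normSq (1 - c) := Complex.normSq_pos.mpr hne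
  have hc2 : c.re * c.re + c.im * c.im < 1 := by
    rw [← Complex.normSq_apply, ← Complex.sq_norm]
    nlinarith [norm_nonneg c]
  have hz := z.im_pos
  have hz' : 0 < (z : ℂ).im := hz
  rw [Complex.div_im, ← sub_div]
  apply div_pos _ hn
  simp
  nlinarith [mul_pos hz (sub_pos.mpr hc2)]

namespace IsHolomorphic

/-- The polydisc form of the Schwarz–Pick lemma: a holomorphic map `ℍⁿ → ℍ` does not increase
hyperbolic distances, where `ℍⁿ` carries the supremum of the hyperbolic distances. -/
theorem lipschitzWith_one {n : ℕ} {f : (Fin n → ℍ) → ℍ} (hf : IsHolomorphic f) :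
    LipschitzWith 1 f := by
  refine LipschitzWith.of_dist_le_mul fun z w => ?_
  rw [NNReal.coe_one, one_mul]
  -- `γ` is the coordinatewise inverse Cayley transform taking `0` to `z`. Following `f ∘ γ` by the
  -- Cayley transform at `f z` gives `Φ`, to which the Schwarz lemma at `0` applies.
  let γ : (Fin n → ℂ) → (Fin n → ℂ) := fun c j =>
    ((z j : ℂ) - (starRingEnd ℂ) (z j : ℂ) * c j) / (1 - c j)
  let F : (Fin n → ℂ) → ℂ := fun w => (f (fun j => UpperHalfPlane.ofComplex (w j)) : ℂ)
  let Φ : (Fin n → ℂ) → ℂ := fun c =>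
    (F (γ c) - f z) / (F (γ c) - (starRingEnd ℂ) (f z : ℂ))
  have hlt : ∀ c ∈ Metric.ball (0 : Fin n → ℂ) 1, ∀ j, ‖c j‖ < 1 := fun c hc j =>
    (norm_le_pi_norm c j).trans_lt (by simpa using hc)
  have hγ : DifferentiableOn ℂ γ (Metric.ball 0 1) := by
    rw [differentiableOn_pi]
    intro j
    have hne : ∀ c ∈ Metric.ball (0 : Fin n → ℂ) 1, 1 - c j ≠ 0 := by
      intro c hc h
      have h1 := hlt c hc j
      have : c j = 1 := by linear_combination -h
      simp [this] at h1
    fun_prop (disch := assumption)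
  have hFγ : DifferentiableOn ℂ (fun c => F (γ c)) (Metric.ball 0 1) :=
    DifferentiableOn.comp (g := F) hf hγ fun c hc j => UpperHalfPlane.im_cayley_inv_pos (z j) (hlt c hc j)
  have hΦ : DifferentiableOn ℂ Φ (Metric.ball 0 1) := by
    have hne : ∀ c ∈ Metric.ball (0 : Fin n → ℂ) 1, F (γ c) - (starRingEnd ℂ) (f z : ℂ) ≠ 0 :=
      fun c _ => norm_pos_iff.mp (UpperHalfPlane.dist_coe_conj_pos (f z) _)
    simp only [Φ]
    simp only [div_eq_mul_inv]
    exact (hFγ.sub_const _).mul ((hFγ.sub_const _).fun_inv hne)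
  have hmaps : Set.MapsTo Φ (Metric.ball 0 1) (Metric.closedBall 0 1) := by
    intro c _
    rw [mem_closedBall_zero_iff, norm_div]
    exact (div_le_one (UpperHalfPlane.dist_coe_conj_pos (f z) _)).mpr
      (UpperHalfPlane.norm_sub_lt_norm_sub_conj _ _).le
  have h0 : Φ 0 = 0 := by
    simp [Φ, F, γ, UpperHalfPlane.ofComplex_apply]
  let c : Fin n → ℂ := fun j => ((w j : ℂ) - z j) / (w j - (starRingEnd ℂ) (z j : ℂ))
  have hc : ‖c‖ ≤ Real.tanh (dist z w / 2) := by
    refine (pi_norm_le_iff_of_nonneg ?_).mpr fun j => ?_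
    · rw [← Real.tanh_zero]
      exact Real.tanh_le_tanh_iff.mpr (by positivity)
    · rw [UpperHalfPlane.norm_cayley]
      refine Real.tanh_le_tanh_iff.mpr ?_
      have := dist_le_pi_dist z w j
      linarith
  have hγc : γ c = fun j => (w j : ℂ) := by
    funext j
    have h1 : (w j : ℂ) - (starRingEnd ℂ) (z j : ℂ) ≠ 0 :=
      norm_pos_iff.mp (UpperHalfPlane.dist_coe_conj_pos (z j) (w j))
    have h2 : (z j : ℂ) - (starRingEnd ℂ) (z j : ℂ) ≠ 0 :=
      norm_pos_iff.mp (UpperHalfPlane.dist_coe_conj_pos (z j) (z j))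
    have h3 : 1 - c j ≠ 0 := by
      have : 1 - c j = ((z j : ℂ) - (starRingEnd ℂ) (z j : ℂ)) /
          (w j - (starRingEnd ℂ) (z j : ℂ)) := by
        simp only [c]; field_simp; ring
      rw [this]
      exact div_ne_zero h2 h1
    simp only [γ]
    rw [div_eq_iff h3]
    simp only [c]
    field_simp
    ring
  have key := Complex.norm_le_norm_of_mapsTo_ball hΦ hmaps h0
    (hc.trans_lt (Real.tanh_lt_one _))
  have hval : ‖Φ c‖ = Real.tanh (dist (f z) (f w) / 2) := by
    rw [← UpperHalfPlane.norm_cayley]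
    simp [Φ, F, hγc, UpperHalfPlane.ofComplex_apply]
  rw [hval] at key
  have := Real.tanh_le_tanh_iff.mp (key.trans hc)
  linarith

end IsHolomorphic

/-! ### First- and second-order behaviour of `f` at the diagonal. -/

namespace DiagFamily

variable {n : ℕ} (f : DiagFamily n)

/-- The map `f` read in the coordinates of `ℂⁿ`. -/
noncomputable def ext (w : Fin n → ℂ) : ℂ :=
  f.toFun fun j => UpperHalfPlane.ofComplex (w j)

theorem ext_coe (z : Fin n → ℍ) : f.ext (fun j => (z j : ℂ)) = f.toFun z := by
  simp [ext, UpperHalfPlane.ofComplex_apply]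

theorem ext_diag (c : ℍ) : f.ext (fun _ => (c : ℂ)) = c := by
  rw [f.ext_coe fun _ => c, f.diag]

theorem differentiableOn_ext : DifferentiableOn ℂ f.ext {w | ∀ j, 0 < (w j).im} := f.holomorphic

theorem isOpen_tube : IsOpen {w : Fin n → ℂ | ∀ j, 0 < (w j).im} := by
  simp only [Set.ofPred_forall]
  exact isOpen_iInter_of_finite fun j =>
    isOpen_lt continuous_const (Complex.continuous_im.comp (continuous_apply j))

theorem differentiableAt_ext {w : Fin n → ℂ} (hw : ∀ j, 0 < (w j).im) :
    DifferentiableAt ℂ f.ext w :=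
  f.differentiableOn_ext.differentiableAt (isOpen_tube.mem_nhds hw)

theorem im_sub_norm_le (c : ℍ) (w : Fin n → ℂ) (j : Fin n) :
    c.im - ‖w - fun _ => (c : ℂ)‖ ≤ (w j).im := by
  have h1 := norm_le_pi_norm (w - fun _ => (c : ℂ)) j
  have h2 := (abs_le.mp (Complex.abs_im_le_norm (w j - (c : ℂ)))).1
  simp only [Pi.sub_apply, Complex.sub_im, UpperHalfPlane.coe_im] at h1 h2
  linarith

/-- Schwarz–Pick against the fixed diagonal point `c`, with hyperbolic distances converted to
Euclidean ones at both ends. -/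
theorem norm_ext_sub_le (c : ℍ) {w : Fin n → ℂ} (h : ‖w - fun _ => (c : ℂ)‖ < c.im) :
    ‖f.ext w - c‖ ≤ c.im * (Real.exp (‖w - fun _ => (c : ℂ)‖ /
      √((c.im - ‖w - fun _ => (c : ℂ)‖) * c.im)) - 1) := by
  set ρ := ‖w - fun _ => (c : ℂ)‖ with hρ
  have hc := c.im_pos
  have hw : ∀ j, 0 < (w j).im := fun j => by linarith [im_sub_norm_le c w j]
  have h1 := UpperHalfPlane.dist_coe_le (f.toFun fun j => UpperHalfPlane.ofComplex (w j)) c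
  rw [dist_eq_norm] at h1
  refine h1.trans (mul_le_mul_of_nonneg_left (sub_le_sub_right (Real.exp_le_exp.mpr ?_) 1) hc.le)
  have h2 := f.holomorphic.lipschitzWith_one.dist_le_mul
    (fun j => UpperHalfPlane.ofComplex (w j)) (fun _ => c)
  rw [f.diag, NNReal.coe_one, one_mul] at h2
  refine h2.trans ((dist_pi_le_iff (by positivity)).mpr fun j => ?_)
  refine (UpperHalfPlane.dist_le_dist_coe_div_sqrt _ _).trans ?_
  rw [UpperHalfPlane.ofComplex_apply_of_im_pos (hw j)]
  have h3 := im_sub_norm_le c w j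
  refine div_le_div₀ (norm_nonneg _) ?_ (Real.sqrt_pos.mpr (mul_pos (by linarith) hc)) ?_
  · rw [dist_eq_norm]
    exact norm_le_pi_norm (w - fun _ => (c : ℂ)) j
  · exact Real.sqrt_le_sqrt (mul_le_mul_of_nonneg_right h3 hc.le)

theorem norm_ext_sub_le_two_mul (c : ℍ) {w : Fin n → ℂ}
    (h : ‖w - fun _ => (c : ℂ)‖ < c.im / 2) : ‖f.ext w - c‖ ≤ 2 * c.im := by
  have hc := c.im_pos
  refine (f.norm_ext_sub_le c (by linarith)).trans ?_
  set ρ := ‖w - fun _ => (c : ℂ)‖ with hρ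
  have h1 : c.im / 2 ≤ √((c.im - ρ) * c.im) := by
    refine Real.le_sqrt_of_sq_le ?_
    nlinarith
  have h2 : ρ / √((c.im - ρ) * c.im) ≤ 1 := by
    rw [div_le_one (by linarith)]
    linarith
  have h3 := Real.exp_le_exp.mpr h2
  have h4 := Real.exp_one_lt_d9
  nlinarith

theorem norm_fderiv_ext_diag_le_one (c : ℍ) : ‖fderiv ℂ f.ext fun _ => (c : ℂ)‖ ≤ 1 := by
  have hc := c.im_pos
  refine le_of_forall_gt_imp_ge_of_dense fun C hC => ?_
  refine norm_fderiv_le_of_lip' ℂ (by linarith) ?_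
  -- The bound of `norm_ext_sub_le` is at most `q ρ * ρ` for small `ρ`, by `exp d - 1 ≤ d + d ^ 2`,
  -- and `q` tends to 1.
  let q : ℝ → ℝ := fun ρ => c.im / √((c.im - ρ) * c.im) * (1 + ρ / √((c.im - ρ) * c.im))
  let N : (Fin n → ℂ) → ℝ := fun w => ‖w - fun _ => (c : ℂ)‖
  have hN : Tendsto N (𝓝 fun _ => (c : ℂ)) (𝓝 0) := by
    have : Continuous N := by fun_prop
    simpa [N] using this.tendsto fun _ => (c : ℂ)
  have hs : √((c.im - 0) * c.im) = c.im := by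
    rw [sub_zero, Real.sqrt_mul_self hc.le]
  have hs' : √((c.im - 0) * c.im) ≠ 0 := by rw [hs]; exact hc.ne'
  have hdiv : ContinuousAt (fun ρ : ℝ => ρ / √((c.im - ρ) * c.im)) 0 := by
    refine ContinuousAt.div (by fun_prop) (by fun_prop) hs'
  have hq : ContinuousAt q 0 := by
    refine ContinuousAt.mul (ContinuousAt.div (by fun_prop) (by fun_prop) hs') ?_
    exact continuousAt_const.add hdiv
  have hq0 : q 0 = 1 := by
    simp only [q, hs]
    field_simp
    simp
  have e1 : ∀ᶠ w in 𝓝 (fun _ : Fin n => (c : ℂ)), q (N w) < C :=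
    (hq.tendsto.comp hN).eventually (gt_mem_nhds (by rw [hq0]; exact hC))
  have e2 : ∀ᶠ w in 𝓝 (fun _ : Fin n => (c : ℂ)), N w / √((c.im - N w) * c.im) < 1 :=
    (hdiv.tendsto.comp hN).eventually (gt_mem_nhds (by simp))
  have e3 : ∀ᶠ w in 𝓝 (fun _ : Fin n => (c : ℂ)), N w < c.im := hN.eventually (gt_mem_nhds hc)
  filter_upwards [e1, e2, e3] with w h1 h2 h3
  rw [f.ext_diag]
  refine (f.norm_ext_sub_le c h3).trans ?_
  change c.im * (Real.exp (N w / √((c.im - N w) * c.im)) - 1) ≤ C * N w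
  have h0 : 0 ≤ N w := norm_nonneg _
  set d := N w / √((c.im - N w) * c.im) with hd
  have hd0 : 0 ≤ d := by positivity
  have hexp := (abs_le.mp (Real.abs_exp_sub_one_sub_id_le (x := d)
    (by rw [abs_of_nonneg hd0]; exact h2.le))).2
  calc c.im * (Real.exp d - 1) ≤ c.im * (d * (1 + d)) := by
        refine mul_le_mul_of_nonneg_left ?_ hc.le
        linarith
    _ = q (N w) * N w := by
        simp only [q, hd]
        ring
    _ ≤ C * N w := mul_le_mul_of_nonneg_right h1.le h0

theorem hasFDerivAt_ext_diag (c : ℍ) :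
    HasFDerivAt f.ext (fderiv ℂ f.ext fun _ => (c : ℂ)) fun _ => (c : ℂ) :=
  (f.differentiableAt_ext fun _ => c.im_pos).hasFDerivAt

theorem fderiv_ext_diag_one (c : ℍ) : fderiv ℂ f.ext (fun _ => (c : ℂ)) (fun _ => 1) = 1 := by
  have h1 : HasDerivAt (fun w : ℂ => (fun _ : Fin n => w)) (fun _ => 1) (c : ℂ) :=
    hasDerivAt_pi.mpr fun _ => hasDerivAt_id _
  have h2 := (f.hasFDerivAt_ext_diag c).comp_hasDerivAt (c : ℂ) h1
  refine h2.unique ((hasDerivAt_id (c : ℂ)).congr_of_eventuallyEq ?_)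
  filter_upwards [(isOpen_lt continuous_const Complex.continuous_im).mem_nhds c.im_pos] with w hw
  exact f.ext_diag ⟨w, hw⟩

/-- Schwarz lemma of order two: the remainder vanishes to second order at `c` and maps the ball of
radius `c.im / 2` into one of radius `(2 + 1) * c.im`. The constant is `3 * 2 ^ 2 = 12`. -/
theorem norm_ext_sub_sub_fderiv_le (c : ℍ) {w : Fin n → ℂ}
    (h : ‖w - fun _ => (c : ℂ)‖ < c.im / 2) :
    ‖f.ext w - c - fderiv ℂ f.ext (fun _ => (c : ℂ)) (w - fun _ => (c : ℂ))‖ ≤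
      12 * ‖w - fun _ => (c : ℂ)‖ ^ 2 / c.im := by
  have hc := c.im_pos
  set D := fderiv ℂ f.ext fun _ => (c : ℂ) with hD
  set cc : Fin n → ℂ := fun _ => (c : ℂ) with hcc
  let H : (Fin n → ℂ) → ℂ := fun w => f.ext w - D (w - cc)
  have hH : DifferentiableOn ℂ H (Metric.ball cc (c.im / 2)) := by
    refine DifferentiableOn.sub ?_ (by fun_prop)
    refine f.differentiableOn_ext.mono fun w hw j => ?_
    rw [mem_ball_iff_norm] at hw
    linarith [im_sub_norm_le c w j]
  have hHc : H cc = c := by simp [H, hcc, f.ext_diag]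
  have hmaps : Set.MapsTo H (Metric.ball cc (c.im / 2)) (Metric.closedBall (H cc) (3 * c.im)) := by
    intro w hw
    rw [mem_ball_iff_norm] at hw
    rw [mem_closedBall_iff_norm, hHc]
    have h1 := f.norm_ext_sub_le_two_mul c hw
    have h2 : ‖D (w - cc)‖ ≤ ‖w - cc‖ := by
      simpa using D.le_of_opNorm_le (f.norm_fderiv_ext_diag_le_one c) (w - cc)
    calc ‖H w - c‖ = ‖(f.ext w - c) - D (w - cc)‖ := by simp only [H]; congr 1; ring
      _ ≤ ‖f.ext w - c‖ + ‖D (w - cc)‖ := norm_sub_le _ _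
      _ ≤ 3 * c.im := by linarith
  have hlit : (H · - H cc) =o[𝓝 cc] (fun w ↦ ‖w - cc‖ ^ 1) := by
    simp only [pow_one]
    refine Asymptotics.IsLittleO.norm_right ?_
    have := (f.hasFDerivAt_ext_diag c).isLittleO
    refine this.congr_left fun w => ?_
    rw [hHc, f.ext_diag]
    simp only [H]
    ring
  have key := Complex.dist_le_mul_div_pow_of_mapsTo_ball_of_isLittleO hH hmaps hlit
    (z := w) (by rw [mem_ball_iff_norm]; exact h)
  rw [hHc, dist_eq_norm, dist_eq_norm] at key
  calc ‖f.ext w - c - D (w - cc)‖ = ‖H w - c‖ := by simp only [H]; congr 1; ring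
    _ ≤ _ := key
    _ = 12 * ‖w - cc‖ ^ 2 / c.im := by
        rw [one_add_one_eq_two]
        have := hc.ne'
        field_simp
        ring

theorem fderiv_ext_diag_apply (c : ℍ) (v : Fin n → ℂ) :
    fderiv ℂ f.ext (fun _ => (c : ℂ)) v =
      ∑ j, fderiv ℂ f.ext (fun _ => (c : ℂ)) (Pi.single j 1) * v j := by
  conv_lhs => rw [← Finset.univ_sum_single v, map_sum]
  refine Finset.sum_congr rfl fun j _ => ?_
  have : (Pi.single j (v j) : Fin n → ℂ) = v j • Pi.single j (1 : ℂ) := by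
    rw [← Pi.single_smul]; simp
  rw [this, map_smul, smul_eq_mul, mul_comm]

/-- Equality case of the triangle inequality: the coefficients sum to 1, and their absolute values
sum to at most 1. -/
theorem re_fderiv_ext_diag_single (c : ℍ) (j : Fin n) :
    (fderiv ℂ f.ext (fun _ => (c : ℂ)) (Pi.single j 1)).re =
      ‖fderiv ℂ f.ext (fun _ => (c : ℂ)) (Pi.single j 1)‖ := by
  set β : Fin n → ℂ := fun j => fderiv ℂ f.ext (fun _ => (c : ℂ)) (Pi.single j 1) with hβ
  have hsum : ∑ j, β j = 1 := by
    rw [← f.fderiv_ext_diag_one c, f.fderiv_ext_diag_apply c]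
    simp [hβ]
  have hnorm : ∑ j, ‖β j‖ ≤ 1 := by
    -- Aligning the phases makes the differential attain the sum of the norms; where `β j = 0` the
    -- quotient is `0 / 0 = 0`.
    let v : Fin n → ℂ := fun j => (starRingEnd ℂ) (β j) / ‖β j‖
    have hv : ‖v‖ ≤ 1 := by
      refine (pi_norm_le_iff_of_nonneg zero_le_one).mpr fun j => ?_
      simp only [v, norm_div, RCLike.norm_conj, Complex.norm_real, norm_norm]
      exact div_self_le_one _
    have h1 : fderiv ℂ f.ext (fun _ => (c : ℂ)) v = ((∑ j, ‖β j‖ : ℝ) : ℂ) := by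
      rw [f.fderiv_ext_diag_apply c]
      push_cast
      refine Finset.sum_congr rfl fun j _ => ?_
      change β j * ((starRingEnd ℂ) (β j) / ‖β j‖) = _
      rw [← mul_div_assoc, Complex.mul_conj, Complex.normSq_eq_norm_sq]
      push_cast
      rw [sq, mul_self_div_self]
    have h2 := (fderiv ℂ f.ext fun _ => (c : ℂ)).le_of_opNorm_le
      (f.norm_fderiv_ext_diag_le_one c) v
    rw [h1, Complex.norm_real, Real.norm_of_nonneg (Finset.sum_nonneg fun _ _ => norm_nonneg _)]
      at h2
    linarith
  have hre : ∑ j, (β j).re = 1 := by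
    rw [← Complex.re_sum, hsum, Complex.one_re]
  have hle : ∀ j ∈ Finset.univ, (β j).re ≤ ‖β j‖ := fun j _ => Complex.re_le_norm _
  exact (Finset.sum_eq_sum_iff_of_le hle).mp
    (le_antisymm (Finset.sum_le_sum hle) (by rw [hre]; exact hnorm)) j (Finset.mem_univ j)

theorem im_fderiv_ext_diag_single (c : ℍ) (j : Fin n) :
    (fderiv ℂ f.ext (fun _ => (c : ℂ)) (Pi.single j 1)).im = 0 := by
  rw [← Complex.abs_re_eq_norm, f.re_fderiv_ext_diag_single c j, abs_norm]

/-- The second-order estimate makes the difference quotients converge locally uniformly in the base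
point, so the limit is holomorphic. -/
theorem differentiableOn_fderiv_ext_diag (j : Fin n) :
    DifferentiableOn ℂ (fun l : ℂ => fderiv ℂ f.ext (fun _ => l) (Pi.single j 1))
      {l | 0 < l.im} := by
  let δ : ℕ → ℝ := fun k => 1 / ((k : ℝ) + 1)
  have hδ : ∀ k, 0 < δ k := fun k => Nat.one_div_pos_of_nat
  have hδ0 : Tendsto δ atTop (𝓝 0) := tendsto_one_div_add_atTop_nhds_zero_nat
  let Q : ℕ → ℂ → ℂ := fun k l =>
    (f.ext (fun i => l + δ k * Pi.single (M := fun _ => ℂ) j 1 i) - l) / δ k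
  have hopen : IsOpen {l : ℂ | 0 < l.im} := isOpen_lt continuous_const Complex.continuous_im
  have him : ∀ k i, ((δ k : ℂ) * Pi.single (M := fun _ => ℂ) j 1 i).im = 0 := by
    intro k i
    rcases eq_or_ne i j with rfl | h
    · simp
    · simp [h]
  have hQ : ∀ k, DifferentiableOn ℂ (Q k) {l | 0 < l.im} := by
    intro k
    refine DifferentiableOn.div_const (DifferentiableOn.sub ?_ differentiableOn_id) _
    refine DifferentiableOn.comp (g := f.ext) f.differentiableOn_ext (by fun_prop) fun l hl i => ?_
    rw [Complex.add_im, him k i, add_zero]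
    exact hl
  refine TendstoLocallyUniformlyOn.differentiableOn (φ := atTop) (F := Q) ?_
    (Eventually.of_forall hQ) hopen
  rw [Metric.tendstoLocallyUniformlyOn_iff]
  intro ε hε x hx
  have hx' : 0 < x.im := hx
  refine ⟨{l | x.im / 2 < l.im}, mem_nhdsWithin_of_mem_nhds
    ((isOpen_lt continuous_const Complex.continuous_im).mem_nhds
      (show x.im / 2 < x.im by linarith)), ?_⟩
  filter_upwards [hδ0.eventually (gt_mem_nhds (show 0 < x.im / 4 by linarith)),
    hδ0.eventually (gt_mem_nhds (show 0 < ε * x.im / 24 by positivity))] with k h1 h2 l hl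
  have hl' : x.im / 2 < l.im := hl
  have hl0 : 0 < l.im := by linarith
  have hdk := hδ k
  have hw : ((fun i => l + δ k * Pi.single (M := fun _ => ℂ) j 1 i) - fun _ : Fin n => l) =
      (δ k : ℂ) • Pi.single (M := fun _ => ℂ) j 1 := by
    funext i
    simp
  have hnorm : ‖(δ k : ℂ) • Pi.single (M := fun _ : Fin n => ℂ) j 1‖ = δ k := by
    rw [norm_smul, Pi.norm_single]
    simp [abs_of_pos hdk]
  have key := f.norm_ext_sub_sub_fderiv_le ⟨l, hl0⟩
    (w := fun i => l + δ k * Pi.single (M := fun _ => ℂ) j 1 i)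
    (by
      change ‖_ - fun _ : Fin n => l‖ < l.im / 2
      rw [hw, hnorm]
      linarith)
  change ‖_ - l - fderiv ℂ f.ext (fun _ => l) (_ - fun _ : Fin n => l)‖ ≤
    12 * ‖_ - fun _ : Fin n => l‖ ^ 2 / l.im at key
  rw [hw, hnorm, map_smul, smul_eq_mul] at key
  rw [dist_comm, dist_eq_norm]
  have hne : (δ k : ℂ) ≠ 0 := by exact_mod_cast hdk.ne'
  have hrw : Q k l - fderiv ℂ f.ext (fun _ => l) (Pi.single j 1) =
      (f.ext (fun i => l + δ k * Pi.single (M := fun _ => ℂ) j 1 i) - l -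
        δ k * fderiv ℂ f.ext (fun _ => l) (Pi.single j 1)) / δ k := by
    simp only [Q]
    field_simp
  rw [hrw, norm_div, Complex.norm_real, Real.norm_of_nonneg hdk.le, div_lt_iff₀ hdk]
  refine key.trans_lt ?_
  rw [div_lt_iff₀ hl0]
  nlinarith [mul_pos hε hdk]

end DiagFamily

theorem Complex.deriv_eq_zero_of_im_eventuallyEq_zero {B : ℂ → ℂ} {x : ℂ}
    (hB : DifferentiableAt ℂ B x) (him : ∀ᶠ l in 𝓝 x, (B l).im = 0) : deriv B x = 0 := by
  have h1 : HasFDerivAt B _ x := hB.hasDerivAt.hasFDerivAt.restrictScalars ℝ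
  have h2 := (Complex.imCLM.hasFDerivAt (x := B x)).comp x h1
  have h3 := h2.unique ((hasFDerivAt_const (0 : ℝ) x).congr_of_eventuallyEq him)
  have e1 := DFunLike.congr_fun h3 1
  have e2 := DFunLike.congr_fun h3 Complex.I
  simp at e1 e2
  exact Complex.ext e2 e1

namespace DiagFamily

variable {n : ℕ} (f : DiagFamily n)

/-- A real-valued holomorphic function on a connected open set is constant. -/
theorem fderiv_ext_diag_single_eq (j : Fin n) (c d : ℍ) :
    fderiv ℂ f.ext (fun _ => (c : ℂ)) (Pi.single j 1) =
      fderiv ℂ f.ext (fun _ => (d : ℂ)) (Pi.single j 1) := by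
  have hopen : IsOpen {l : ℂ | 0 < l.im} := isOpen_lt continuous_const Complex.continuous_im
  refine hopen.is_const_of_deriv_eq_zero (convex_halfSpace_im_gt 0).isPreconnected
    (f.differentiableOn_fderiv_ext_diag j) (fun x hx => ?_) c.im_pos d.im_pos
  refine Complex.deriv_eq_zero_of_im_eventuallyEq_zero
    ((f.differentiableOn_fderiv_ext_diag j).differentiableAt (hopen.mem_nhds hx)) ?_
  filter_upwards [hopen.mem_nhds hx] with l hl
  exact f.im_fderiv_ext_diag_single ⟨l, hl⟩ j

theorem partialDeriv_eq (j : Fin n) (c : ℍ) :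
    partialDeriv f.toFun j (fun _ => c) = fderiv ℂ f.ext (fun _ => (c : ℂ)) (Pi.single j 1) := by
  have h1 := hasDerivAt_update (fun _ : Fin n => (c : ℂ)) j (c : ℂ)
  have h2 : HasFDerivAt f.ext (fderiv ℂ f.ext fun _ => (c : ℂ))
      (Function.update (fun _ : Fin n => (c : ℂ)) j (c : ℂ)) := by
    rw [Function.update_eq_self_iff.mpr rfl]
    exact f.hasFDerivAt_ext_diag c
  refine Eq.trans ?_ (h2.comp_hasDerivAt (c : ℂ) h1).deriv
  unfold partialDeriv
  congr 1
  funext w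
  simp only [Function.comp_apply, ext]
  congr 2
  funext i
  rcases eq_or_ne i j with rfl | h
  · simp
  · simp [h, UpperHalfPlane.ofComplex_apply]

/-- The weights `∂f/∂z_j(i, …, i)`. -/
noncomputable def weight (j : Fin n) : ℝ :=
  ‖partialDeriv f.toFun j fun _ => UpperHalfPlane.I‖

theorem weight_nonneg (j : Fin n) : 0 ≤ f.weight j := norm_nonneg _

theorem fderiv_ext_diag_single (j : Fin n) (c : ℍ) :
    fderiv ℂ f.ext (fun _ => (c : ℂ)) (Pi.single j 1) = f.weight j := by
  rw [weight, partialDeriv_eq, f.fderiv_ext_diag_single_eq j c UpperHalfPlane.I]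
  apply Complex.ext
  · rw [f.re_fderiv_ext_diag_single, Complex.ofReal_re]
  · rw [f.im_fderiv_ext_diag_single, Complex.ofReal_im]

theorem partialDeriv_eq_weight (j : Fin n) :
    partialDeriv f.toFun j (fun _ => UpperHalfPlane.I) = f.weight j := by
  rw [partialDeriv_eq, fderiv_ext_diag_single]

theorem sum_weight : ∑ j, f.weight j = 1 := by
  have h := f.fderiv_ext_diag_one UpperHalfPlane.I
  rw [fderiv_ext_diag_apply] at h
  simp only [fderiv_ext_diag_single, mul_one] at h
  exact_mod_cast h

theorem norm_ext_add_sub_sub_sum_le (c : ℍ) {v : Fin n → ℂ} (hv : ‖v‖ < c.im / 2) :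
    ‖f.ext (fun j => v j + c) - c - ∑ j, f.weight j * v j‖ ≤ 12 * ‖v‖ ^ 2 / c.im := by
  have hw : (fun j => v j + (c : ℂ)) - (fun _ => (c : ℂ)) = v := by
    funext j
    simp
  have h := f.norm_ext_sub_sub_fderiv_le c (w := fun j => v j + (c : ℂ)) (by rwa [hw])
  rw [hw, fderiv_ext_diag_apply] at h
  simpa only [fderiv_ext_diag_single] using h

/-- The linear map `g(z) = ∑ α_j z_j`. -/
noncomputable def linearization : DiagFamily n where
  toFun z := ⟨∑ j, f.weight j * (z j : ℂ), by
    obtain ⟨j, -, hj⟩ : ∃ j ∈ Finset.univ, 0 < f.weight j := by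
      by_contra! h
      have := Finset.sum_nonpos h
      rw [f.sum_weight] at this
      linarith
    simp only [Complex.im_sum, Complex.im_ofReal_mul]
    exact Finset.sum_pos' (fun i _ => mul_nonneg (f.weight_nonneg i) (z i).im_pos.le)
      ⟨j, Finset.mem_univ j, mul_pos hj (z j).im_pos⟩⟩
  holomorphic := by
    refine DifferentiableOn.congr (f := fun w : Fin n → ℂ => ∑ j, (f.weight j : ℂ) * w j)
      (by fun_prop) fun w hw => ?_
    change ∑ j, (f.weight j : ℂ) * (UpperHalfPlane.ofComplex (w j) : ℂ) = _
    refine Finset.sum_congr rfl fun j _ => ?_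
    rw [UpperHalfPlane.ofComplex_apply_of_im_pos (hw j)]
  diag c := by
    apply UpperHalfPlane.ext
    change ∑ j, (f.weight j : ℂ) * (c : ℂ) = c
    rw [← Finset.sum_mul, ← Complex.ofReal_sum, f.sum_weight, Complex.ofReal_one, one_mul]

theorem coe_linearization (z : Fin n → ℍ) :
    (f.linearization.toFun z : ℂ) = ∑ j, f.weight j * (z j : ℂ) := rfl

end DiagFamily

/-! ### Uniform means and contour shifting. -/

/-- The averages of `u` over intervals of length `T` tend to zero as `T → ∞`, uniformly in the
position of the interval. -/
def UniformMeanZero {E : Type*} [NormedAddCommGroup E] [NormedSpace ℝ E] (u : ℝ → E) : Prop :=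
  ∀ ε : ℝ, 0 < ε → ∃ T₀ : ℝ, 0 < T₀ ∧ ∀ a T : ℝ, T₀ ≤ T → ‖∫ t in a..a + T, u t‖ ≤ ε * T

/-- A holomorphic function on the closed upper half-plane that is bounded on horizontal strips and
is uniformly small on high horizontal lines has uniform mean zero on the real line. -/
theorem DifferentiableOn.uniformMeanZero {ψ : ℂ → ℂ} (hψ : DifferentiableOn ℂ ψ {l | 0 ≤ l.im})
    (hb : ∀ Y : ℝ, ∃ B : ℝ, ∀ l : ℂ, 0 ≤ l.im → l.im ≤ Y → ‖ψ l‖ ≤ B)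
    (hd : ∀ ε : ℝ, 0 < ε → ∃ Y : ℝ, 0 < Y ∧ ∀ x : ℝ, ‖ψ (x + Y * Complex.I)‖ ≤ ε) :
    UniformMeanZero fun t : ℝ => ψ t := by
  intro ε hε
  obtain ⟨Y, hY, hψY⟩ := hd (ε / 2) (by linarith)
  obtain ⟨B, hB⟩ := hb Y
  have hB0 : 0 ≤ B := (norm_nonneg _).trans (hB 0 (by simp) (by simpa using hY.le))
  -- The two vertical sides of the rectangle contribute at most `2 * Y * B`, which must not exceed
  -- half of `ε * T`.
  refine ⟨4 * Y * B / ε + 1, by positivity, fun a T hT => ?_⟩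
  have hT0 : 0 < T := lt_of_lt_of_le (by positivity) hT
  have hYB : 2 * (Y * B) ≤ ε / 2 * T := by
    have h1 : 4 * Y * B / ε ≤ T := by linarith
    rw [div_le_iff₀ hε] at h1
    linarith
  have hrect := Complex.integral_boundary_rect_eq_zero_of_differentiableOn ψ (a : ℂ)
    ((a + T : ℝ) + Y * Complex.I) (hψ.mono fun l hl => by
      have h2 := hl.2
      simp only [Set.mem_preimage, Complex.ofReal_im, Complex.add_im, Complex.mul_im,
        Complex.I_im, Complex.I_re, Complex.ofReal_re, mul_one, mul_zero, add_zero, zero_add,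
        Set.uIcc_of_le hY.le] at h2
      exact h2.1)
  simp only [Complex.ofReal_im, Complex.add_im, Complex.mul_im, Complex.I_im, Complex.I_re,
    Complex.ofReal_re, mul_one, mul_zero, add_zero, zero_add, Complex.add_re, Complex.mul_re,
    sub_zero, Complex.ofReal_zero, zero_mul] at hrect
  have hvert : ∀ x : ℝ, ‖Complex.I • ∫ y in (0 : ℝ)..Y, ψ (x + y * Complex.I)‖ ≤ Y * B := by
    intro x
    rw [norm_smul, Complex.norm_I, one_mul, mul_comm]
    have h := intervalIntegral.norm_integral_le_of_norm_le_const (a := 0) (b := Y) (C := B)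
      (f := fun y : ℝ => ψ (x + y * Complex.I)) fun y hy => by
        rw [Set.uIoc_of_le hY.le] at hy
        exact hB _ (by simpa using hy.1.le) (by simpa using hy.2)
    simpa [abs_of_pos hY] using h
  have hhor : ‖∫ x in a..a + T, ψ (x + Y * Complex.I)‖ ≤ ε / 2 * T := by
    have h := intervalIntegral.norm_integral_le_of_norm_le_const (a := a) (b := a + T) (C := ε / 2)
      (f := fun x : ℝ => ψ (x + Y * Complex.I)) fun x _ => hψY x
    simpa [abs_of_pos hT0] using h
  have heq : ∫ t in a..a + T, ψ t = (∫ x in a..a + T, ψ (x + Y * Complex.I)) -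
      (Complex.I • ∫ y in (0 : ℝ)..Y, ψ ((a + T : ℝ) + y * Complex.I)) +
      Complex.I • ∫ y in (0 : ℝ)..Y, ψ (a + y * Complex.I) := by
    linear_combination hrect
  rw [heq]
  refine (norm_add_le _ _).trans ((add_le_add_left (norm_sub_le _ _) _).trans ?_)
  have h1 := hvert (a + T)
  have h2 := hvert a
  linarith

namespace UniformMeanZero

theorem clm_comp {E F : Type*} [NormedAddCommGroup E] [NormedSpace ℝ E] [CompleteSpace E]
    [NormedAddCommGroup F] [NormedSpace ℝ F] [CompleteSpace F] {u : ℝ → E}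
    (h : UniformMeanZero u) (hu : Continuous u) (L : E →L[ℝ] F) :
    UniformMeanZero fun t => L (u t) := by
  intro ε hε
  obtain ⟨T₀, hT₀, hT⟩ := h (ε / (‖L‖ + 1)) (by positivity)
  refine ⟨T₀, hT₀, fun a T h1 => ?_⟩
  rw [L.intervalIntegral_comp_comm (hu.intervalIntegrable _ _)]
  have h2 := (L.le_opNorm (∫ t in a..a + T, u t)).trans
    (mul_le_mul_of_nonneg_left (hT a T h1) (norm_nonneg _))
  refine h2.trans ?_
  have h3 : ‖L‖ * (ε / (‖L‖ + 1) * T) = (‖L‖ / (‖L‖ + 1)) * (ε * T) := by ring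
  rw [h3]
  refine mul_le_of_le_one_left (by nlinarith) ?_
  rw [div_le_one (by positivity)]
  linarith

end UniformMeanZero

/-! ### The deviation from the linear map has mean zero. -/

namespace DiagFamily

variable {n : ℕ} (f : DiagFamily n)

/-- The deviation of `f` from its linearization along the complex line `z + ℂ (1, …, 1)`. -/
noncomputable def deviation (z : Fin n → ℍ) (l : ℂ) : ℂ :=
  f.ext (fun j => (z j : ℂ) + l) - l - ∑ j, f.weight j * (z j : ℂ)

theorem differentiableOn_deviation (z : Fin n → ℍ) :
    DifferentiableOn ℂ (f.deviation z) {l | 0 ≤ l.im} := by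
  refine DifferentiableOn.sub_const (DifferentiableOn.sub ?_ differentiableOn_id) _
  refine DifferentiableOn.comp (g := f.ext) f.differentiableOn_ext (by fun_prop) fun l hl j => ?_
  rw [Complex.add_im]
  exact add_pos_of_pos_of_nonneg (z j).im_pos hl

theorem continuous_deviation (z : Fin n → ℍ) : Continuous fun t : ℝ => f.deviation z t :=
  (f.differentiableOn_deviation z).continuousOn.comp_continuous Complex.continuous_ofReal
    fun t => by simp

/-- The diagonal point `i + l` serves as a reference: its hyperbolic distance to `z + l` is bounded
by `K` for all `l` with `0 ≤ Im l`, hence so is the distance of the images. -/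
theorem exists_norm_deviation_le (z : Fin n → ℍ) (Y : ℝ) :
    ∃ B : ℝ, ∀ l : ℂ, 0 ≤ l.im → l.im ≤ Y → ‖f.deviation z l‖ ≤ B := by
  set K : ℝ := ∑ j, ‖(z j : ℂ) - Complex.I‖ / √(z j).im with hK
  have hK0 : 0 ≤ K := Finset.sum_nonneg fun j _ => by positivity
  refine ⟨(1 + Y) * (Real.exp K - 1) + 1 + ‖∑ j, f.weight j * (z j : ℂ)‖, fun l h0 hl => ?_⟩
  have hz : ∀ j, 0 < ((z j : ℂ) + l).im := fun j => by
    rw [Complex.add_im]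
    exact add_pos_of_pos_of_nonneg (z j).im_pos h0
  have hI : 0 < (Complex.I + l).im := by simpa using by linarith
  let z' : Fin n → ℍ := fun j => ⟨(z j : ℂ) + l, hz j⟩
  let c : ℍ := ⟨Complex.I + l, hI⟩
  have hdist : dist z' (fun _ => c) ≤ K := by
    refine (dist_pi_le_iff hK0).mpr fun j => ?_
    refine (UpperHalfPlane.dist_le_dist_coe_div_sqrt _ _).trans ?_
    refine le_trans ?_ (Finset.single_le_sum (f := fun j => ‖(z j : ℂ) - Complex.I‖ / √(z j).im)
      (fun i _ => by positivity) (Finset.mem_univ j))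
    have hy := (z j).im_pos
    have e1 : dist ((z' j : ℍ) : ℂ) (c : ℂ) = ‖(z j : ℂ) - Complex.I‖ := by
      rw [dist_eq_norm]
      congr 1
      change (z j : ℂ) + l - (Complex.I + l) = _
      ring
    have e2 : (z' j).im = (z j).im + l.im := by
      change ((z j : ℂ) + l).im = _
      simp
    have e3 : c.im = 1 + l.im := by
      change (Complex.I + l).im = _
      simp
    rw [e1, e2, e3]
    refine div_le_div_of_nonneg_left (norm_nonneg _) (Real.sqrt_pos.mpr hy) ?_
    exact Real.sqrt_le_sqrt (by nlinarith)
  have h1 := UpperHalfPlane.dist_coe_le (f.toFun z') c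
  have h2 := f.holomorphic.lipschitzWith_one.dist_le_mul z' (fun _ => c)
  rw [f.diag, NNReal.coe_one, one_mul] at h2
  have h3 : c.im = 1 + l.im := by
    change (Complex.I + l).im = _
    simp
  have h4 : f.ext (fun j => (z j : ℂ) + l) = f.toFun z' := f.ext_coe z'
  have h5 : ‖(f.toFun z' : ℂ) - c‖ ≤ (1 + Y) * (Real.exp K - 1) := by
    rw [← dist_eq_norm]
    refine h1.trans (mul_le_mul (by linarith) (sub_le_sub_right
      (Real.exp_le_exp.mpr (h2.trans hdist)) 1) ?_ (by linarith))
    rw [sub_nonneg]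
    exact Real.one_le_exp dist_nonneg
  have h6 : f.deviation z l =
      ((f.toFun z' : ℂ) - c) + Complex.I - ∑ j, f.weight j * (z j : ℂ) := by
    have : (c : ℂ) = Complex.I + l := rfl
    rw [deviation, h4, this]
    ring
  rw [h6]
  refine (norm_sub_le _ _).trans (add_le_add_left ((norm_add_le _ _).trans ?_) _)
  rw [Complex.norm_I]
  linarith

/-- The second-order estimate based at `x + iY` with increment `z`; its error `12 ‖z‖² / Y` does not
depend on `x`. -/
theorem exists_norm_deviation_add_mul_I_le (z : Fin n → ℍ) (ε : ℝ) (hε : 0 < ε) :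
    ∃ Y : ℝ, 0 < Y ∧ ∀ x : ℝ, ‖f.deviation z (x + Y * Complex.I)‖ ≤ ε := by
  set v : Fin n → ℂ := fun j => z j with hv
  refine ⟨2 * ‖v‖ + 1 + 12 * ‖v‖ ^ 2 / ε, by positivity, fun x => ?_⟩
  set Y := 2 * ‖v‖ + 1 + 12 * ‖v‖ ^ 2 / ε with hY
  have hY0 : 0 < Y := by positivity
  have him : ((x : ℂ) + Y * Complex.I).im = Y := by simp
  let c : ℍ := ⟨x + Y * Complex.I, by rw [him]; exact hY0⟩
  have hc : c.im = Y := him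
  have hq : 0 ≤ 12 * ‖v‖ ^ 2 / ε := by positivity
  have h := f.norm_ext_add_sub_sub_sum_le c (v := v) (by rw [hc]; linarith)
  refine h.trans ?_
  rw [hc, div_le_iff₀ hY0]
  have h1 : ε * (12 * ‖v‖ ^ 2 / ε) = 12 * ‖v‖ ^ 2 := by field_simp
  have h2 := norm_nonneg v
  nlinarith

theorem uniformMeanZero_deviation (z : Fin n → ℍ) :
    UniformMeanZero fun t : ℝ => f.deviation z t :=
  (f.differentiableOn_deviation z).uniformMeanZero (f.exists_norm_deviation_le z)
    (f.exists_norm_deviation_add_mul_I_le z)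

theorem uniformMeanZero_deviation_sq (z : Fin n → ℍ) :
    UniformMeanZero fun t : ℝ => f.deviation z t ^ 2 := by
  refine ((f.differentiableOn_deviation z).fun_pow 2).uniformMeanZero (fun Y => ?_) fun ε hε => ?_
  · obtain ⟨B, hB⟩ := f.exists_norm_deviation_le z Y
    refine ⟨B ^ 2, fun l h0 hl => ?_⟩
    rw [norm_pow]
    exact pow_le_pow_left₀ (norm_nonneg _) (hB l h0 hl) 2
  · obtain ⟨Y, hY, h⟩ := f.exists_norm_deviation_add_mul_I_le z (min ε 1) (by positivity)
    refine ⟨Y, hY, fun x => ?_⟩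
    rw [norm_pow]
    have h1 := (h x).trans (min_le_left _ _)
    have h2 := (h x).trans (min_le_right _ _)
    nlinarith [norm_nonneg (f.deviation z (x + Y * Complex.I))]

/-! ### Mean convergence of the imaginary part, then of the whole deviation. -/

/-- The imaginary part of `f` along the real line `z + ℝ (1, …, 1)`. -/
noncomputable def height (z : Fin n → ℍ) (t : ℝ) : ℝ := (f.toFun fun j => t +ᵥ z j).im

theorem ext_add_ofReal (z : Fin n → ℍ) (t : ℝ) :
    f.ext (fun j => (z j : ℂ) + t) = f.toFun fun j => t +ᵥ z j := by
  rw [← ext_coe]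
  congr 1
  funext j
  rw [UpperHalfPlane.coe_vadd, add_comm]

theorem im_deviation (z : Fin n → ℍ) (t : ℝ) :
    (f.deviation z t).im = f.height z t - ∑ j, f.weight j * (z j).im := by
  rw [deviation, ext_add_ofReal, height]
  simp

theorem height_eq (z : Fin n → ℍ) (t : ℝ) :
    f.height z t = (f.deviation z t).im + ∑ j, f.weight j * (z j).im := by
  rw [im_deviation, sub_add_cancel]

theorem continuous_height (z : Fin n → ℍ) : Continuous (f.height z) := by
  have : f.height z = fun t : ℝ => (f.deviation z t).im + ∑ j, f.weight j * (z j).im :=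
    funext (f.height_eq z)
  rw [this]
  exact (Complex.continuous_im.comp (f.continuous_deviation z)).add continuous_const

theorem uniformMeanZero_height (z : Fin n → ℍ) :
    UniformMeanZero fun t : ℝ => f.height z t - ∑ j, f.weight j * (z j).im := by
  have h := (f.uniformMeanZero_deviation z).clm_comp (f.continuous_deviation z) Complex.imCLM
  simpa only [Complex.imCLM_apply, im_deviation] using h

theorem height_nonneg (z : Fin n → ℍ) (t : ℝ) : 0 ≤ f.height z t := (UpperHalfPlane.im_pos _).le

/-- The point `x + i s y`, for `z = x + i y`. -/
def stretch (s : ℝ) (hs : 0 < s) (z : Fin n → ℍ) : Fin n → ℍ := fun j =>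
  ⟨⟨(z j).re, s * (z j).im⟩, mul_pos hs (z j).im_pos⟩

theorem im_stretch (s : ℝ) (hs : 0 < s) (z : Fin n → ℍ) (j : Fin n) :
    (stretch s hs z j).im = s * (z j).im := rfl

theorem re_stretch (s : ℝ) (hs : 0 < s) (z : Fin n → ℍ) (j : Fin n) :
    (stretch s hs z j).re = (z j).re := rfl

/-- Corresponding points lie on vertical lines at hyperbolic distance `log s`, and moving by
distance `d` changes an imaginary part by a factor of at most `exp d`. -/
theorem height_stretch_le (z : Fin n → ℍ) {s : ℝ} (hs : 1 ≤ s) (t : ℝ) :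
    f.height (stretch s (one_pos.trans_le hs) z) t ≤ s * f.height z t := by
  have hs0 : 0 < s := one_pos.trans_le hs
  refine (UpperHalfPlane.im_le_im_mul_exp_dist _ (f.toFun fun j => t +ᵥ z j)).trans ?_
  rw [mul_comm]
  refine mul_le_mul_of_nonneg_right ?_ (f.height_nonneg z t)
  rw [← Real.le_log_iff_exp_le hs0]
  refine (f.holomorphic.lipschitzWith_one.dist_le_mul _ _).trans ?_
  rw [NNReal.coe_one, one_mul]
  refine (dist_pi_le_iff (Real.log_nonneg hs)).mpr fun j => ?_
  rw [UpperHalfPlane.dist_of_re_eq (by simp [UpperHalfPlane.vadd_re, re_stretch])]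
  rw [UpperHalfPlane.vadd_im, UpperHalfPlane.vadd_im, im_stretch,
    Real.log_mul hs0.ne' (z j).im_pos.ne', Real.dist_eq, add_sub_cancel_right,
    abs_of_nonneg (Real.log_nonneg hs)]

/-- At heights at least `s * m`, a horizontal move by `|t - t'|` costs hyperbolic distance at most
`|t - t'| / (s * m)`. For large `s` the height is nearly constant on long intervals. -/
theorem height_stretch_le_exp_mul (z : Fin n → ℍ) {m s : ℝ} (hm : 0 < m)
    (hmz : ∀ j, m ≤ (z j).im) (hs : 0 < s) (t t' : ℝ) :
    f.height (stretch s hs z) t ≤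
      Real.exp (|t - t'| / (s * m)) * f.height (stretch s hs z) t' := by
  refine (UpperHalfPlane.im_le_im_mul_exp_dist _
    (f.toFun fun j => t' +ᵥ stretch s hs z j)).trans ?_
  rw [mul_comm]
  refine mul_le_mul_of_nonneg_right (Real.exp_le_exp.mpr ?_) (f.height_nonneg _ t')
  refine (f.holomorphic.lipschitzWith_one.dist_le_mul _ _).trans ?_
  rw [NNReal.coe_one, one_mul]
  refine (dist_pi_le_iff (by positivity)).mpr fun j => ?_
  refine (UpperHalfPlane.dist_le_dist_coe_div_sqrt _ _).trans ?_
  rw [UpperHalfPlane.vadd_im, UpperHalfPlane.vadd_im, im_stretch,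
    Real.sqrt_mul_self (mul_pos hs (z j).im_pos).le, UpperHalfPlane.coe_vadd,
    UpperHalfPlane.coe_vadd, dist_add_right, dist_eq_norm, ← Complex.ofReal_sub,
    Complex.norm_real, Real.norm_eq_abs]
  exact div_le_div_of_nonneg_left (abs_nonneg _) (by positivity)
    (mul_le_mul_of_nonneg_left (hmz j) hs.le)

theorem exists_im_lower_bound (z : Fin n → ℍ) : ∃ m : ℝ, 0 < m ∧ ∀ j, m ≤ (z j).im := by
  rcases isEmpty_or_nonempty (Fin n) with h | h
  · exact ⟨1, one_pos, fun j => h.elim j⟩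
  · obtain ⟨j, hj⟩ := Finite.exists_min fun j => (z j).im
    exact ⟨(z j).im, (z j).im_pos, hj⟩

/-- Fix a length `T` on which the mean of the height of `z` is nearly `G`, then take `s` so large
that the stretched height varies little over such an interval. Its value at `t` is then bounded by
`s` times that mean. -/
theorem exists_height_stretch_le (z : Fin n → ℍ) {ε : ℝ} (hε : 0 < ε) :
    ∃ (s : ℝ) (hs : 1 ≤ s), ∀ t,
      f.height (stretch s (one_pos.trans_le hs) z) t ≤
        s * (∑ j, f.weight j * (z j).im + ε) := by
  set G := ∑ j, f.weight j * (z j).im with hG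
  have hG0 : 0 ≤ G := Finset.sum_nonneg fun j _ => mul_nonneg (f.weight_nonneg j) (z j).im_pos.le
  obtain ⟨m, hm, hmz⟩ := exists_im_lower_bound z
  obtain ⟨T, hT, hmean⟩ := f.uniformMeanZero_height z (ε / 2) (by linarith)
  have hlim : Tendsto (fun s : ℝ => Real.exp (T / (s * m)) * (G + ε / 2)) atTop
      (𝓝 (Real.exp 0 * (G + ε / 2))) := by
    refine Tendsto.mul_const _ ((Real.continuous_exp.tendsto 0).comp ?_)
    exact tendsto_const_nhds.div_atTop (tendsto_id.atTop_mul_const hm)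
  obtain ⟨s, hsG, hs⟩ := ((hlim.eventually (gt_mem_nhds
    (show Real.exp 0 * (G + ε / 2) < G + ε by rw [Real.exp_zero]; linarith))).and
    (eventually_ge_atTop 1)).exists
  have hs0 : 0 < s := one_pos.trans_le hs
  refine ⟨s, hs, fun t => ?_⟩
  have hint : IntervalIntegrable (f.height z) volume t (t + T) :=
    (f.continuous_height z).intervalIntegrable _ _
  have h1 : ∫ τ in t..t + T, f.height z τ ≤ T * (G + ε / 2) := by
    have h := (le_abs_self _).trans (hmean t T le_rfl)
    rw [intervalIntegral.integral_sub hint intervalIntegrable_const,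
      intervalIntegral.integral_const, add_sub_cancel_left, smul_eq_mul] at h
    linarith
  have h2 : T * f.height (stretch s hs0 z) t ≤
      Real.exp (T / (s * m)) * s * ∫ τ in t..t + T, f.height z τ := by
    have hc : ∫ _ in t..t + T, f.height (stretch s hs0 z) t =
        T * f.height (stretch s hs0 z) t := by
      rw [intervalIntegral.integral_const, add_sub_cancel_left, smul_eq_mul]
    rw [← hc, ← intervalIntegral.integral_const_mul]
    refine intervalIntegral.integral_mono_on (by linarith) intervalIntegrable_const
      (hint.const_mul _) fun τ hτ => ?_
    refine (f.height_stretch_le_exp_mul z hm hmz hs0 t τ).trans ?_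
    rw [mul_assoc]
    refine mul_le_mul (Real.exp_le_exp.mpr ?_) (f.height_stretch_le z hs τ)
      (f.height_nonneg _ _) (Real.exp_pos _).le
    refine div_le_div_of_nonneg_right ?_ (by positivity)
    rw [abs_le]
    constructor <;> linarith [hτ.1, hτ.2]
  have h3 : T * f.height (stretch s hs0 z) t ≤ T * (s * (G + ε)) := by
    refine h2.trans ((mul_le_mul_of_nonneg_left h1 (by positivity)).trans ?_)
    have : Real.exp (T / (s * m)) * s * (T * (G + ε / 2)) =
        T * (s * (Real.exp (T / (s * m)) * (G + ε / 2))) := by ring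
    rw [this]
    gcongr
  exact le_of_mul_le_mul_left h3 hT

theorem uniformMeanZero_abs_height (z : Fin n → ℍ) :
    UniformMeanZero fun t : ℝ => |f.height z t - ∑ j, f.weight j * (z j).im| := by
  intro ε hε
  set G := ∑ j, f.weight j * (z j).im with hG
  set δ := ε / 5 with hδ
  have hδ0 : 0 < δ := by positivity
  obtain ⟨s, hs, hsz⟩ := f.exists_height_stretch_le z hδ0
  have hs0 : 0 < s := one_pos.trans_le hs
  set z' := stretch s hs0 z with hz'
  have hG' : ∑ j, f.weight j * (z' j).im = s * G := by
    rw [hG, Finset.mul_sum]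
    refine Finset.sum_congr rfl fun j _ => ?_
    rw [hz', im_stretch]
    ring
  obtain ⟨T₁, hT₁, h1⟩ := f.uniformMeanZero_height z δ hδ0
  obtain ⟨T₂, hT₂, h2⟩ := f.uniformMeanZero_height z' (s * δ) (by positivity)
  rw [hG'] at h2
  refine ⟨max T₁ T₂, lt_max_of_lt_left hT₁, fun a T hT => ?_⟩
  have hT0 : 0 < T := hT₁.trans_le ((le_max_left _ _).trans hT)
  have e1 := (le_abs_self _).trans (h1 a T ((le_max_left _ _).trans hT))
  have e2 := (neg_le_abs _).trans (h2 a T ((le_max_right _ _).trans hT))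
  have c1 := f.continuous_height z
  have c2 := f.continuous_height z'
  rw [Real.norm_of_nonneg (intervalIntegral.integral_nonneg (by linarith) fun _ _ => abs_nonneg _)]
  -- Let `V` be the height of `z` and `W` that of `z'` divided by `s`. Since `W ≤ V` and `W ≤ G +
  -- δ`, the sum `(V - W) + (G - W) + 2δ` dominates `|V - G|`. Its linear terms have small mean; the
  -- total is `δ + 2δ + 2δ = ε`.
  have hpt : ∀ t, |f.height z t - G| ≤
      (f.height z t - G) - 2 / s * (f.height z' t - s * G) + 2 * δ := by
    intro t
    have hV : f.height z' t / s ≤ f.height z t := by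
      rw [div_le_iff₀' hs0]
      exact f.height_stretch_le z hs t
    have hW : f.height z' t / s ≤ G + δ := by
      rw [div_le_iff₀' hs0]
      exact hsz t
    have hr : 2 / s * (f.height z' t - s * G) = 2 * (f.height z' t / s) - 2 * G := by
      field_simp
    rw [hr, abs_le]
    constructor <;> linarith
  calc ∫ t in a..a + T, |f.height z t - G|
      ≤ ∫ t in a..a + T, ((f.height z t - G) - 2 / s * (f.height z' t - s * G) + 2 * δ) := by
        refine intervalIntegral.integral_mono (by linarith)
          (Continuous.intervalIntegrable (by fun_prop) _ _)
          (Continuous.intervalIntegrable (by fun_prop) _ _) hpt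
    _ = (∫ t in a..a + T, (f.height z t - G)) -
          2 / s * (∫ t in a..a + T, (f.height z' t - s * G)) + T * (2 * δ) := by
        rw [intervalIntegral.integral_add (Continuous.intervalIntegrable (by fun_prop) _ _)
          intervalIntegrable_const, intervalIntegral.integral_sub
          (Continuous.intervalIntegrable (by fun_prop) _ _)
          (Continuous.intervalIntegrable (by fun_prop) _ _),
          intervalIntegral.integral_const_mul, intervalIntegral.integral_const,
          add_sub_cancel_left, smul_eq_mul]
    _ ≤ δ * T + 2 / s * (s * δ * T) + T * (2 * δ) := by
        have := mul_le_mul_of_nonneg_left e2 (show 0 ≤ 2 / s by positivity)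
        linarith
    _ = ε * T := by
        rw [hδ]
        field_simp
        ring

theorem uniformMeanZero_norm_deviation_sq (z : Fin n → ℍ) :
    UniformMeanZero fun t : ℝ => ‖f.deviation z t‖ ^ 2 := by
  intro ε hε
  obtain ⟨B, hB⟩ := f.exists_norm_deviation_le z 0
  have hB0 : 0 ≤ B := (norm_nonneg _).trans (hB 0 (by simp) (by simp))
  have cu := f.continuous_deviation z
  have cui : Continuous fun t : ℝ => (f.deviation z t).im := Complex.continuous_im.comp cu
  have cur : Continuous fun t : ℝ => (f.deviation z t ^ 2).re :=
    Complex.continuous_re.comp (cu.pow 2)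
  have hre := (f.uniformMeanZero_deviation_sq z).clm_comp (cu.pow 2) Complex.reCLM
  simp only [Complex.reCLM_apply] at hre
  have him := f.uniformMeanZero_abs_height z
  simp only [← im_deviation] at him
  obtain ⟨T₁, hT₁, h1⟩ := hre (ε / 2) (by positivity)
  obtain ⟨T₂, hT₂, h2⟩ := him (ε / (4 * (B + 1))) (by positivity)
  refine ⟨max T₁ T₂, lt_max_of_lt_left hT₁, fun a T hT => ?_⟩
  have hT0 : 0 < T := hT₁.trans_le ((le_max_left _ _).trans hT)
  have e1 := (le_abs_self _).trans (h1 a T ((le_max_left _ _).trans hT))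
  have e2 := (le_abs_self _).trans (h2 a T ((le_max_right _ _).trans hT))
  rw [Real.norm_of_nonneg (intervalIntegral.integral_nonneg (by linarith) fun _ _ => by positivity)]
  -- Uses `|u|² = Re(u²) + 2 (Im u)²` and `|Im u| ≤ B`.
  have hpt : ∀ t : ℝ, ‖f.deviation z t‖ ^ 2 ≤
      (f.deviation z t ^ 2).re + 2 * B * |(f.deviation z t).im| := by
    intro t
    have hb := (Complex.abs_im_le_norm _).trans (hB t (by simp) (by simp))
    rw [Complex.sq_norm, Complex.normSq_apply, sq (f.deviation z t), Complex.mul_re]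
    nlinarith [abs_nonneg (f.deviation z t).im, abs_mul_abs_self (f.deviation z t).im]
  calc ∫ t in a..a + T, ‖f.deviation z t‖ ^ 2
      ≤ ∫ t in a..a + T, ((f.deviation z t ^ 2).re + 2 * B * |(f.deviation z t).im|) :=
        intervalIntegral.integral_mono (by linarith)
          (Continuous.intervalIntegrable (by fun_prop) _ _)
          (Continuous.intervalIntegrable (by fun_prop) _ _) hpt
    _ = (∫ t in a..a + T, (f.deviation z t ^ 2).re) +
          2 * B * ∫ t in a..a + T, |(f.deviation z t).im| := by
        rw [intervalIntegral.integral_add (cur.intervalIntegrable _ _)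
          (Continuous.intervalIntegrable (by fun_prop) _ _), intervalIntegral.integral_const_mul]
    _ ≤ ε / 2 * T + 2 * B * (ε / (4 * (B + 1)) * T) :=
        add_le_add e1 (mul_le_mul_of_nonneg_left e2 (by positivity))
    _ ≤ ε * T := by
        have h3 : 2 * B * (ε / (4 * (B + 1)) * T) = B / (B + 1) * (ε / 2 * T) := by
          field_simp
          ring
        have h4 : B / (B + 1) ≤ 1 := by
          rw [div_le_one (by positivity)]
          linarith
        have h5 := mul_le_mul_of_nonneg_right h4 (show 0 ≤ ε / 2 * T by positivity)
        linarith

end DiagFamily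

/-! ### From mean convergence at points to the compact-open topology and weak convergence. -/

namespace DiagFamily

variable {n : ℕ} (f : DiagFamily n)

/-- By equicontinuity, closeness at finitely many points controls the compact-open topology. -/
theorem exists_finite_forall_dist_lt_mem {g : DiagFamily n} {U : Set (DiagFamily n)}
    (hU : IsOpen U) (hg : g ∈ U) :
    ∃ (F : Set (Fin n → ℍ)) (δ : ℝ), F.Finite ∧ 0 < δ ∧
      ∀ h : DiagFamily n, (∀ z ∈ F, dist (h.toFun z) (g.toFun z) < δ) → h ∈ U := by
  obtain ⟨V, hV, rfl⟩ := isOpen_induced_iff.mp hU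
  have hVg : V ∈ 𝓝 g.toContinuousMap := hV.mem_nhds hg
  obtain ⟨⟨K, ε⟩, ⟨hK, hε⟩, hsub⟩ := (nhds_basis_uniformity'
    (Metric.uniformity_basis_dist.compactConvergenceUniformity
      (α := Fin n → ℍ) (β := ℍ))).mem_iff.mp hVg
  have hε' : 0 < ε / 3 := by
    have : 0 < ε := hε
    positivity
  obtain ⟨F, -, hF, hKF⟩ := hK.finite_cover_balls hε'
  refine ⟨F, ε / 3, hF, hε', fun h hh => hsub fun z hz => ?_⟩
  obtain ⟨w, hw, hzw⟩ := Set.mem_iUnion₂.mp (hKF hz)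
  rw [Metric.mem_ball] at hzw
  have h1 := h.holomorphic.lipschitzWith_one.dist_le_mul w z
  have h2 := g.holomorphic.lipschitzWith_one.dist_le_mul z w
  rw [NNReal.coe_one, one_mul] at h1 h2
  rw [dist_comm] at h1
  have h3 := hh w hw
  have h4 : dist (g.toFun z) (h.toFun z) ≤
      dist (g.toFun z) (g.toFun w) + dist (g.toFun w) (h.toFun w) +
        dist (h.toFun w) (h.toFun z) := dist_triangle4 _ _ _ _
  rw [dist_comm (g.toFun w)] at h4
  rw [dist_comm (h.toFun w) (h.toFun z)] at h4
  rw [dist_comm w z] at h1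
  change dist (g.toFun z) (h.toFun z) < ε
  linarith

theorem translate_sub_linearization (z : Fin n → ℍ) (t : ℝ) :
    ((f.translate t).toFun z : ℂ) - f.linearization.toFun z = f.deviation z (-t : ℝ) := by
  rw [deviation, ext_add_ofReal, coe_linearization]
  change ((t +ᵥ f.toFun (fun j => (-t) +ᵥ z j) : ℍ) : ℂ) - _ = _
  rw [UpperHalfPlane.coe_vadd]
  push_cast
  ring

theorem exists_volume_norm_sub_ge_le (z : Fin n → ℍ) {η : ℝ} (hη : 0 < η) {ε : ℝ} (hε : 0 < ε) :
    ∃ R : ℝ, 0 < R ∧ ∀ r : ℝ, R ≤ r →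
      volume {t : ℝ | t ∈ Set.Icc (-r) r ∧
        η ≤ ‖((f.translate t).toFun z : ℂ) - f.linearization.toFun z‖} ≤
          ENNReal.ofReal (ε * r) := by
  -- Chebyshev at level `η ^ 2`; the factor `1 / 2` compensates for the length `2 * r` of the
  -- interval.
  obtain ⟨R, hR, h⟩ := f.uniformMeanZero_norm_deviation_sq z (η ^ 2 * ε / 2) (by positivity)
  refine ⟨R, hR, fun r hr => ?_⟩
  have hr0 : 0 < r := hR.trans_le hr
  have hcont : Continuous fun t : ℝ => ‖f.deviation z (-t : ℝ)‖ ^ 2 :=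
    ((f.continuous_deviation z).comp continuous_neg).norm.pow 2
  have hint : IntegrableOn (fun t : ℝ => ‖f.deviation z (-t : ℝ)‖ ^ 2) (Set.Icc (-r) r) :=
    hcont.continuousOn.integrableOn_compact isCompact_Icc
  have hcheb := mul_meas_ge_le_integral_of_nonneg (μ := volume.restrict (Set.Icc (-r) r))
    (f := fun t : ℝ => ‖f.deviation z (-t : ℝ)‖ ^ 2)
    (Eventually.of_forall fun t => by positivity) hint (η ^ 2)
  have hI : ∫ t in Set.Icc (-r) r, ‖f.deviation z (-t : ℝ)‖ ^ 2 ≤ η ^ 2 * (ε * r) := by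
    rw [integral_Icc_eq_integral_Ioc, ← intervalIntegral.integral_of_le (by linarith),
      intervalIntegral.integral_comp_neg (fun t : ℝ => ‖f.deviation z t‖ ^ 2), neg_neg]
    have h1 := (le_abs_self _).trans (h (-r) (2 * r) (by linarith))
    rw [show -r + 2 * r = r by ring] at h1
    linarith
  have hle := le_of_mul_le_mul_left (hcheb.trans hI) (by positivity)
  have hset : {t : ℝ | t ∈ Set.Icc (-r) r ∧
      η ≤ ‖((f.translate t).toFun z : ℂ) - f.linearization.toFun z‖} ⊆
      {t : ℝ | η ^ 2 ≤ ‖f.deviation z (-t : ℝ)‖ ^ 2} ∩ Set.Icc (-r) r := by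
    rintro t ⟨ht, hηt⟩
    rw [translate_sub_linearization] at hηt
    exact ⟨pow_le_pow_left₀ hη.le hηt 2, ht⟩
  refine (measure_mono hset).trans ?_
  rw [← Measure.restrict_apply (measurableSet_le measurable_const hcont.measurable)]
  rw [measureReal_def] at hle
  exact (ENNReal.le_ofReal_iff_toReal_le (measure_ne_top _ _) (by positivity)).mpr hle

theorem exists_volume_exists_norm_sub_ge_le {F : Set (Fin n → ℍ)} (hF : F.Finite)
    {η : (Fin n → ℍ) → ℝ} (hη : ∀ z, 0 < η z) :
    ∀ ε : ℝ, 0 < ε → ∃ R : ℝ, 0 < R ∧ ∀ r : ℝ, R ≤ r →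
      volume {t : ℝ | t ∈ Set.Icc (-r) r ∧
        ∃ z ∈ F, η z ≤ ‖((f.translate t).toFun z : ℂ) - f.linearization.toFun z‖} ≤
          ENNReal.ofReal (ε * r) := by
  induction F, hF using Set.Finite.induction_on with
  | empty => exact fun ε hε => ⟨1, one_pos, fun r hr => by simp⟩
  | @insert z F _ _ ih =>
    intro ε hε
    obtain ⟨R₁, hR₁, h1⟩ := f.exists_volume_norm_sub_ge_le z (hη z) (half_pos hε)
    obtain ⟨R₂, hR₂, h2⟩ := ih (ε / 2) (half_pos hε)
    refine ⟨max R₁ R₂, lt_max_of_lt_left hR₁, fun r hr => ?_⟩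
    have hr0 : 0 < r := hR₁.trans_le ((le_max_left _ _).trans hr)
    have hsum : ENNReal.ofReal (ε * r) =
        ENNReal.ofReal (ε / 2 * r) + ENNReal.ofReal (ε / 2 * r) := by
      rw [← ENNReal.ofReal_add (by positivity) (by positivity)]
      congr 1
      ring
    rw [hsum]
    refine le_trans (measure_mono ?_) ((measure_union_le _ _).trans
      (add_le_add (h1 r ((le_max_left _ _).trans hr)) (h2 r ((le_max_right _ _).trans hr))))
    rintro t ⟨ht, w, hw, hwt⟩
    rcases Set.mem_insert_iff.mp hw with rfl | hw
    · exact Or.inl ⟨ht, hwt⟩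
    · exact Or.inr ⟨ht, w, hw, hwt⟩

/-- The orbit of `f` spends asymptotically all its time near the linearization of `f`. -/
theorem exists_volume_translate_notMem_le {U : Set (DiagFamily n)} (hU : IsOpen U)
    (hg : f.linearization ∈ U) {ε : ℝ} (hε : 0 < ε) :
    ∃ R : ℝ, 0 < R ∧ ∀ r : ℝ, R ≤ r →
      volume {t : ℝ | t ∈ Set.Icc (-r) r ∧ f.translate t ∉ U} ≤ ENNReal.ofReal (ε * r) := by
  obtain ⟨F, δ, hF, hδ, hFU⟩ := exists_finite_forall_dist_lt_mem hU hg
  -- The mean estimates are Euclidean and the neighbourhood is hyperbolic, so the Euclidean radius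
  -- depends on the point.
  have hη : ∀ z : Fin n → ℍ, ∃ η : ℝ, 0 < η ∧ ∀ w : ℍ,
      ‖(w : ℂ) - f.linearization.toFun z‖ < η → dist w (f.linearization.toFun z) < δ := by
    intro z
    have hmem := Metric.ball_mem_nhds (f.linearization.toFun z) hδ
    rw [UpperHalfPlane.isEmbedding_coe.nhds_eq_comap] at hmem
    obtain ⟨η, hη, hsub⟩ := (Metric.nhds_basis_ball.comap _).mem_iff.mp hmem
    refine ⟨η, hη, fun w hw => hsub ?_⟩
    rw [Set.mem_preimage, mem_ball_iff_norm]
    exact hw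
  choose η hη0 hηδ using hη
  obtain ⟨R, hR, h⟩ := f.exists_volume_exists_norm_sub_ge_le hF hη0 ε hε
  refine ⟨R, hR, fun r hr => (measure_mono ?_).trans (h r hr)⟩
  rintro t ⟨ht, htU⟩
  refine ⟨ht, ?_⟩
  by_contra! hcon
  exact htU (hFU _ fun z hz => hηδ z _ (hcon z hz))

theorem exists_le_volume_translate_mem {U : Set (DiagFamily n)} (hU : IsOpen U)
    (hg : f.linearization ∈ U) {ε : ℝ} (hε : 0 < ε) :
    ∃ R : ℝ, ∀ r : ℝ, R ≤ r → ENNReal.ofReal ((1 - ε) * r) ≤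
      volume {t : ℝ | t ∈ Set.Icc (-(r / 2)) (r / 2) ∧ f.translate t ∈ U} := by
  obtain ⟨R, hR, h⟩ := f.exists_volume_translate_notMem_le hU hg hε
  refine ⟨2 * R, fun r hr => ?_⟩
  have hr0 : 0 < r := by linarith
  have hbad := h (r / 2) (by linarith)
  have hbad' := hbad.trans (ENNReal.ofReal_le_ofReal (show ε * (r / 2) ≤ ε * r by nlinarith))
  rw [show (1 - ε) * r = r - ε * r by ring, ENNReal.ofReal_sub _ (by positivity),
    tsub_le_iff_right]
  refine le_trans ?_ (add_le_add_right hbad' _)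
  have hvol : ENNReal.ofReal r = volume (Set.Icc (-(r / 2)) (r / 2)) := by
    rw [Real.volume_Icc]
    congr 1
    ring
  rw [hvol]
  refine (measure_mono fun t ht => ?_).trans (measure_union_le _ _)
  by_cases htU : f.translate t ∈ U
  · exact Or.inl ⟨ht, htU⟩
  · exact Or.inr ⟨ht, htU⟩

theorem eventually_orbitMeasure_compl_le {U : Set (DiagFamily n)} (hU : IsOpen U)
    (hg : f.linearization ∈ U) {ε : ℝ} (hε : 0 < ε) :
    ∀ᶠ r in atTop, (f.orbitMeasure r : Measure (DiagFamily n)) Uᶜ ≤ ENNReal.ofReal ε := by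
  obtain ⟨R, hR, h⟩ := f.exists_volume_translate_notMem_le hU hg hε
  filter_upwards [eventually_ge_atTop (⟨R, hR⟩ : Set.Ioi (0 : ℝ))] with r hr
  have hr0 : (0 : ℝ) < r := r.2
  have hrR : R ≤ (r : ℝ) := hr
  change ((ProbabilityTheory.cond volume (Set.Icc (-(r : ℝ)) r)).map f.translate) Uᶜ ≤ _
  rw [Measure.map_apply f.continuous_translate.measurable hU.measurableSet.compl,
    cond_apply measurableSet_Icc, Real.volume_Icc]
  have hb : volume (Set.Icc (-(r : ℝ)) r ∩ f.translate ⁻¹' Uᶜ) ≤ ENNReal.ofReal (ε * r) := h r hrR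
  refine (mul_le_mul_right hb _).trans ?_
  rw [← ENNReal.ofReal_inv_of_pos (by linarith), ← ENNReal.ofReal_mul (by
    rw [inv_nonneg]; linarith)]
  refine ENNReal.ofReal_le_ofReal ?_
  rw [inv_mul_le_iff₀ (by linarith)]
  nlinarith

theorem tendsto_orbitMeasure :
    Tendsto f.orbitMeasure atTop (𝓝 (diracProba f.linearization)) := by
  have : (atTop : Filter (Set.Ioi (0 : ℝ))).IsCountablyGenerated := by
    rw [atTop_Ioi_eq]
    infer_instance
  -- Portmanteau criterion on open sets: only those containing the linearization give a nontrivial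
  -- condition.
  refine tendsto_of_forall_isOpen_le_liminf' fun U hU => ?_
  change Measure.dirac f.linearization U ≤ _
  rw [Measure.dirac_apply' _ hU.measurableSet]
  by_cases hg : f.linearization ∈ U
  · rw [Set.indicator_of_mem hg, Pi.one_apply]
    refine ENNReal.le_of_forall_pos_le_add fun ε hε _ => ?_
    rw [← tsub_le_iff_right]
    refine le_liminf_of_le (by isBoundedDefault) ?_
    filter_upwards [f.eventually_orbitMeasure_compl_le hU hg (ε := ε) hε] with r hr
    rw [ENNReal.ofReal_coe_nnreal] at hr
    rw [tsub_le_iff_right, ← prob_add_prob_compl (μ := (f.orbitMeasure r : Measure _))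
      hU.measurableSet]
    exact add_le_add_right hr _
  · rw [Set.indicator_of_notMem hg]
    exact zero_le

end DiagFamily

theorem theorem4p1 (n : ℕ) (f : DiagFamily n) :
    ∃ g : DiagFamily n,
      (∀ z : Fin n → ℍ, (g.toFun z : ℂ) =
        ∑ j : Fin n, partialDeriv f.toFun j (fun _ => UpperHalfPlane.I) * (z j : ℂ)) ∧
      (∀ U : Set (DiagFamily n), IsOpen U → g ∈ U → ∀ ε : ℝ, 0 < ε →
        ∃ R : ℝ, ∀ r : ℝ, R ≤ r →
          ENNReal.ofReal ((1 - ε) * r) ≤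
            volume {t : ℝ | t ∈ Set.Icc (-(r / 2)) (r / 2) ∧ f.translate t ∈ U}) ∧
      Tendsto f.orbitMeasure atTop (𝓝 (diracProba g)) := by
  refine ⟨f.linearization, fun z => ?_, fun U hU hg ε hε =>
    f.exists_le_volume_translate_mem hU hg hε, f.tendsto_orbitMeasure⟩
  simp only [f.partialDeriv_eq_weight, f.coe_linearization]
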